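/- For $d\ge 0$, let $\mathsf T_d$ be the boundary of the $(d+1)$-dimensional cross-polytope $\operatorname{conv}\{\pm e_1,\dots,\pm e_{d+1}\}\subset\mathbb R^{d+1}$, regarded as a simplicial complex with vertex set $V(\mathsf T_d)=\{\pm e_1,\dots,\pm e_{d+1}\}$. Given a labeling $\lambda:V(\mathsf T_d)\to\{1,\dots,d+1\}$, a *fully-labeled simplex* is a $d$-dimensional simplex of $\mathsf T_d$ (so one with $d+1$ vertices) whose vertices have pairwise distinct labels. Consider the following problem. Input: an integer $d\ge 0$, an arbitrary labeling $\lambda:V(\mathsf T_d)\to\{1,\dots,d+1\}$, given by the explicit list of the labels (in binary) of all $2(d+1)$ vertices, and a fully-labeled simplex $\sigma$. Output: a fully-labeled simplex $\sigma'\neq\sigma$. Then for every input such a $\sigma'$ exists, and the problem can be solved in polynomial time: there is a (deterministic, multi-stack) Turing machine which, on every input, outputs such a $\sigma'$ after a number of steps bounded by a polynomial in the length of the input. -/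

import Mathlib

open Computability

/-- The vertices of the `(d+1)`-dimensional cross-polytope: `(i, true)` stands for the basis vector
`e_i` and `(i, false)` for `-e_i`. -/
abbrev CPVertex (d : ℕ) : Type := Fin (d + 1) × Bool

/-- The point of `ℝ^(d+1)` that a vertex stands for. -/
noncomputable def CPVertex.point {d : ℕ} (v : CPVertex d) : EuclideanSpace ℝ (Fin (d + 1)) :=
  EuclideanSpace.single v.1 (if v.2 then 1 else -1)

/-- The `(d+1)`-dimensional cross-polytope: the convex hull of the vectors of the standard
orthonormal basis and of their negatives. -/
noncomputable def crossPolytope (d : ℕ) : Set (EuclideanSpace ℝ (Fin (d + 1))) :=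
  convexHull ℝ (Set.range (CPVertex.point (d := d)))

/-- A nonempty set of vertices is (the vertex set of) a simplex of the boundary of the
cross-polytope if its convex hull lies in that boundary. -/
def IsBoundarySimplex {d : ℕ} (s : Finset (CPVertex d)) : Prop :=
  s.Nonempty ∧ convexHull ℝ (CPVertex.point '' (s : Set (CPVertex d))) ⊆ frontier (crossPolytope d)

/-- A fully-labeled simplex: a `d`-dimensional simplex of the boundary (that is, one with `d+1`
vertices) whose vertices have pairwise distinct labels. The type `Fin (d + 1)` of labels stands for
`{1, …, d+1}`. -/
def IsFullyLabeled {d : ℕ} (label : CPVertex d → Fin (d + 1)) (s : Finset (CPVertex d)) : Prop :=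
  IsBoundarySimplex s ∧ s.card = d + 1 ∧ Set.InjOn label (s : Set (CPVertex d))

/-- An input of the problem: a dimension, a labeling, and a fully-labeled simplex. -/
structure AnotherSimplexInstance where
  d : ℕ
  label : CPVertex d → Fin (d + 1)
  given : Finset (CPVertex d)
  fullyLabeled : IsFullyLabeled label given

/-- All vertices, in the order `e_1, -e_1, e_2, -e_2, …, e_(d+1), -e_(d+1)`. -/
def cpVertexList (d : ℕ) : List (CPVertex d) :=
  (List.finRange (d + 1)).flatMap fun i => [(i, true), (i, false)]

/-- The input as a word over the three letters `some false`, `some true` (bits) and `none` (end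
marker): for each vertex in turn, a bit telling whether it belongs to the given simplex, then its
label in binary, then the end marker. -/
def encodeInstance (I : AnotherSimplexInstance) : List (Option Bool) :=
  (cpVertexList I.d).flatMap fun v =>
    (decide (v ∈ I.given) :: encodeNat ((I.label v : ℕ) + 1)).map some ++ [none]

/-- A set of vertices of a cross-polytope as a bit string: its membership bits, in the order of
`cpVertexList`. -/
def encodeVertexSet (x : Σ d : ℕ, Finset (CPVertex d)) : List Bool :=
  (cpVertexList x.1).map fun v => decide (v ∈ x.2)

theorem mem_cpVertexList {d : ℕ} (v : CPVertex d) : v ∈ cpVertexList d := by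
  obtain ⟨i, b⟩ := v
  cases b <;> simp [cpVertexList]

theorem length_cpVertexList (d : ℕ) : (cpVertexList d).length = 2 * (d + 1) := by
  simp [cpVertexList, mul_comm]

/-- Distinct vertex sets have distinct codes. -/
theorem encodeVertexSet_injective : Function.Injective encodeVertexSet := by
  rintro ⟨d, s⟩ ⟨d', s'⟩ h
  have hl := congrArg List.length h
  simp only [encodeVertexSet, List.length_map, length_cpVertexList] at hl
  obtain rfl : d = d' := by omega
  obtain rfl : s = s' := by
    ext v
    have := (List.map_inj_left.1 h) v (mem_cpVertexList v)
    simpa using this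
  rfl

theorem blocks_injective {α β : Type} (g : α → List Bool) (g' : β → List Bool) :
    ∀ (l : List α) (l' : List β),
      (l.flatMap fun a => (g a).map some ++ [none]) =
        (l'.flatMap fun a => (g' a).map some ++ [none]) → l.map g = l'.map g'
  | [], [], _ => rfl
  | [], _ :: _, h => by simp at h
  | _ :: _, [], h => by simp at h
  | a :: l, b :: l', h => by
    have key : ∀ (x y : List Bool) (u w : List (Option Bool)),
        x.map some ++ none :: u = y.map some ++ none :: w → x = y ∧ u = w := by
      intro x
      induction x with
      | nil => intro y u w h; cases y <;> simp_all
      | cons c x ih =>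
        intro y u w h
        cases y with
        | nil => simp at h
        | cons e y =>
          simp only [List.map_cons, List.cons_append, List.cons.injEq, Option.some.injEq] at h
          obtain ⟨h1, h2⟩ := ih y u w h.2
          exact ⟨by rw [h.1, h1], h2⟩
    simp only [List.flatMap_cons, List.append_assoc, List.singleton_append] at h
    obtain ⟨h1, h2⟩ := key _ _ _ _ h
    simp [h1, blocks_injective g g' l l' h2]

/-- Distinct inputs have distinct codes. -/
theorem encodeInstance_injective : Function.Injective encodeInstance := by
  rintro ⟨d, lab, s, hs⟩ ⟨d', lab', s', hs'⟩ h
  have h := blocks_injective _ _ _ _ h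
  have hl := congrArg List.length h
  simp only [List.length_map, length_cpVertexList] at hl
  obtain rfl : d = d' := by omega
  have h v := (List.map_inj_left.1 h) v (mem_cpVertexList v)
  simp only [List.cons.injEq] at h
  obtain rfl : s = s' := by ext v; simpa using (h v).1
  obtain rfl : lab = lab' := by
    ext v
    have := congrArg decodeNat (h v).2
    simpa using this
  rfl

/-! A `d`-simplex of the boundary contains no two antipodal vertices, because their midpoint `0` is
an interior point of the polytope. It therefore chooses one sign on each axis, and conversely every
choice of signs spans a simplex (`isBoundarySimplex_orthantSimplex`). The labels of the given
simplex form a bijection from axes to labels. So a label `c` determines an axis, and the antipode on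
that axis carries a label `succLabel c`. This self-map of a finite set has a cycle. Exchanging
exactly the vertices with labels on the cycle for their antipodes permutes the labels on the cycle
and keeps all others, so the result is again fully labeled (`isFullyLabeled_another`). It is a
different simplex since a cycle is nonempty.

The cycle is found without detecting a repetition: if `n` is at least the number of labels, the
labels visited at times `n, …, 2n - 1` are permuted by the map (`injOn_lateOrbit`). The input length
`L` can serve as `n`. The machine fills two unary clocks with `L` ticks while reading. Each round
scans all axes and replaces the target label by its successor; the rounds of the first clock lead
into the cycle, those of the second mark it. A round takes `O(L²)` steps, so the total time is
cubic. `runs_program` gives the time bound, and `output_finalAxes` identifies the result with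
`another`. -/

/-! ### Simplices of the cross-polytope boundary -/

namespace CPVertex

variable {d : ℕ}

theorem point_mem_crossPolytope (v : CPVertex d) : v.point ∈ crossPolytope d :=
  subset_convexHull ℝ _ ⟨v, rfl⟩

theorem point_neg (i : Fin (d + 1)) (b : Bool) : point (i, !b) = -point (i, b) := by
  ext j
  cases b <;> by_cases h : j = i <;> simp [point, h]

theorem point_apply (v : CPVertex d) (j : Fin (d + 1)) :
    v.point j = if j = v.1 then (if v.2 then 1 else -1) else 0 := by
  simp [point]

end CPVertex

open CPVertex

/-- The open `ℓ¹` unit ball is a neighbourhood of `0` inside the polytope. -/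
theorem zero_mem_interior_crossPolytope (d : ℕ) :
    (0 : EuclideanSpace ℝ (Fin (d + 1))) ∈ interior (crossPolytope d) := by
  rw [mem_interior]
  refine ⟨{x | ∑ i, |x i| < 1}, ?_, ?_, by simp⟩
  · intro x hx
    have hx : ∑ i, |x i| < 1 := hx
    have h0 : (0 : EuclideanSpace ℝ (Fin (d + 1))) ∈ crossPolytope d := by
      have := (convex_convexHull ℝ (Set.range (point (d := d)))).midpoint_mem
        (point_mem_crossPolytope (0, true)) (point_mem_crossPolytope (0, !true))
      rwa [point_neg, midpoint_self_neg] at this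
    -- `x` is a convex combination: weight `|x i|` on the vertex of axis `i` with the sign of `x i`,
    -- and the remaining weight on `0`.
    have key : ∑ i : Option (Fin (d + 1)),
        (i.elim (1 - ∑ i, |x i|) fun i => |x i|) •
          (i.elim (0 : EuclideanSpace ℝ (Fin (d + 1))) fun i => point (i, decide (0 ≤ x i))) ∈
        crossPolytope d := by
      refine (convex_convexHull ℝ _).sum_mem ?_ ?_ ?_
      · rintro (_ | i) -
        · simpa using hx.le
        · simp
      · simp [Fintype.sum_option]
      · rintro (_ | i) -
        · exact h0
        · exact point_mem_crossPolytope _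
    convert key using 1
    ext j
    simp only [Fintype.sum_option, Option.elim, smul_zero, zero_add, WithLp.ofLp_sum,
      Finset.sum_apply, PiLp.smul_apply, point_apply, smul_eq_mul, mul_ite, mul_zero]
    rw [Finset.sum_ite_eq Finset.univ j]
    rcases le_or_gt 0 (x j) with h | h
    · simp [h, abs_of_nonneg h]
    · simp [h.not_ge, abs_of_neg h]
  · exact isOpen_lt (by fun_prop) continuous_const

/-- A boundary simplex contains no two antipodal vertices. -/
theorem IsBoundarySimplex.not_mem_opposite {d : ℕ} {s : Finset (CPVertex d)}
    (hs : IsBoundarySimplex s) {i : Fin (d + 1)} {b : Bool} (h : (i, b) ∈ s) : (i, !b) ∉ s := by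
  intro h'
  have := (convex_convexHull ℝ (point '' (s : Set (CPVertex d)))).midpoint_mem
    (subset_convexHull ℝ _ ⟨_, h, rfl⟩) (subset_convexHull ℝ _ ⟨_, h', rfl⟩)
  rw [point_neg, midpoint_self_neg] at this
  exact (hs.2 this).2 (zero_mem_interior_crossPolytope d)

/-- The vertex set that takes from each axis the vertex with the given sign. -/
def orthantSimplex {d : ℕ} (s : Fin (d + 1) → Bool) : Finset (CPVertex d) :=
  Finset.univ.image fun i => (i, s i)

@[simp] theorem mem_orthantSimplex {d : ℕ} {s : Fin (d + 1) → Bool} {v : CPVertex d} :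
    v ∈ orthantSimplex s ↔ v.2 = s v.1 := by
  obtain ⟨i, b⟩ := v
  simp [orthantSimplex, eq_comm]

theorem card_orthantSimplex {d : ℕ} (s : Fin (d + 1) → Bool) :
    (orthantSimplex s).card = d + 1 := by
  rw [orthantSimplex, Finset.card_image_of_injective _ fun i j h => congrArg Prod.fst h]
  simp

/-- The functional `∑ ± x i` with the signs `s` is at most `1` on the polytope and equal to `1` on
the simplex. An interior point of the polytope could be scaled by some `c > 1` without leaving it,
so it cannot have the value `1`. -/
theorem isBoundarySimplex_orthantSimplex {d : ℕ} (s : Fin (d + 1) → Bool) :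
    IsBoundarySimplex (orthantSimplex s) := by
  refine ⟨⟨(0, s 0), by simp⟩, ?_⟩
  let e : Fin (d + 1) → ℝ := fun i => if s i then 1 else -1
  let f : EuclideanSpace ℝ (Fin (d + 1)) →ₗ[ℝ] ℝ :=
    { toFun := fun x => ∑ i, e i * x i
      map_add' := fun x y => by simp [mul_add, Finset.sum_add_distrib]
      map_smul' := fun c x => by simp [Finset.mul_sum, mul_left_comm] }
  have hf (x) : f x = ∑ i, e i * x i := rfl
  have hfp (v : CPVertex d) : f v.point = e v.1 * (if v.2 then 1 else -1) := by
    simp [hf, point_apply]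
  have hle : crossPolytope d ⊆ {x | f x ≤ 1} := by
    refine convexHull_min ?_ (convex_halfSpace_le f.isLinear 1)
    rintro _ ⟨v, rfl⟩
    simp only [Set.mem_ofPred_eq, hfp, e]
    split_ifs <;> norm_num
  have heq : convexHull ℝ (point '' (orthantSimplex s : Set (CPVertex d))) ⊆ {x | f x = 1} := by
    refine convexHull_min ?_ (convex_hyperplane f.isLinear 1)
    rintro _ ⟨v, hv, rfl⟩
    have hv : v.2 = s v.1 := by simpa using hv
    simp only [Set.mem_ofPred_eq, hfp, e, hv]
    split_ifs <;> norm_num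
  intro x hx
  refine ⟨subset_closure (convexHull_mono (Set.image_subset_range _ _) hx), fun hi => ?_⟩
  have hlim : Filter.Tendsto (fun c : ℝ => c • x) (nhdsWithin 1 (Set.Ioi 1)) (nhds x) := by
    have : Continuous fun c : ℝ => c • x := by fun_prop
    simpa using (this.tendsto 1).mono_left nhdsWithin_le_nhds
  obtain ⟨c, hc, hc1⟩ := ((hlim.eventually (isOpen_interior.mem_nhds hi)).and
    self_mem_nhdsWithin).exists
  have h1 : f (c • x) ≤ 1 := hle (interior_subset hc)
  have h2 : f x = 1 := heq hx
  rw [map_smul, h2, smul_eq_mul, mul_one] at h1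
  exact absurd hc1 (not_lt.2 h1)

theorem isFullyLabeled_orthantSimplex {d : ℕ} {label : CPVertex d → Fin (d + 1)}
    {s : Fin (d + 1) → Bool} (h : Function.Injective fun i => label (i, s i)) :
    IsFullyLabeled label (orthantSimplex s) := by
  refine ⟨isBoundarySimplex_orthantSimplex s, card_orthantSimplex s, ?_⟩
  rintro ⟨i, b⟩ hb ⟨j, c⟩ hc hbc
  obtain rfl : b = s i := by simpa using hb
  obtain rfl : c = s j := by simpa using hc
  obtain rfl : i = j := h hbc
  rfl

/-- The sign of the axis `i` in a vertex set: whether `e_i` belongs to it. -/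
def axisSign {d : ℕ} (S : Finset (CPVertex d)) (i : Fin (d + 1)) : Bool :=
  decide ((i, true) ∈ S)

/-- Without antipodal pairs there is at most one vertex per axis, and there are as many vertices as
axes. -/
theorem IsFullyLabeled.eq_orthantSimplex {d : ℕ} {label : CPVertex d → Fin (d + 1)}
    {S : Finset (CPVertex d)} (h : IsFullyLabeled label S) : S = orthantSimplex (axisSign S) := by
  refine Finset.eq_of_subset_of_card_le ?_ (by rw [h.2.1, card_orthantSimplex])
  rintro ⟨i, b⟩ hb
  have := h.1.not_mem_opposite hb
  cases b <;> simpa [axisSign] using ‹_›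

theorem IsFullyLabeled.injective_label {d : ℕ} {label : CPVertex d → Fin (d + 1)}
    {S : Finset (CPVertex d)} (h : IsFullyLabeled label S) :
    Function.Injective fun i => label (i, axisSign S i) := by
  intro i j hij
  have hm (i) : (i, axisSign S i) ∈ S := by
    have := Finset.ext_iff.1 h.eq_orthantSimplex (i, axisSign S i)
    simpa using this
  exact congrArg Prod.fst (h.2.2 (hm i) (hm j) hij)

/-! ### Late orbits of a self-map of a finite set -/

/-- The part of the orbit of `x` under `f` that is visited at the times `n, …, 2 * n - 1`. -/
def lateOrbit {α : Type*} [DecidableEq α] (f : α → α) (x : α) (n : ℕ) : Finset α :=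
  (Finset.range n).image fun k => f^[n + k] x

/-- By pigeonhole the orbit is periodic from some time `i < n` on, with period `j - i ≤ n`. Hence
the late orbit contains all points visited from time `n` on, and `f` maps it onto itself; on a
finite set this forces injectivity. -/
theorem injOn_lateOrbit {α : Type*} [DecidableEq α] [Fintype α] (f : α → α) (x : α) {n : ℕ}
    (hn : Fintype.card α ≤ n) : Set.InjOn f (lateOrbit f x n : Set α) ∧
      Set.MapsTo f (lateOrbit f x n : Set α) (lateOrbit f x n) := by
  obtain ⟨i, j, hij, hjn, he⟩ : ∃ i j, i < j ∧ j ≤ n ∧ f^[i] x = f^[j] x := by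
    obtain ⟨i, j, hij, he⟩ := Fintype.exists_ne_map_eq_of_card_lt
      (fun k : Fin (n + 1) => f^[k] x) (by simpa using Nat.lt_succ_of_le hn)
    rcases lt_or_gt_of_ne hij with h | h
    · exact ⟨i, j, h, Nat.lt_succ_iff.1 j.2, he⟩
    · exact ⟨j, i, h, Nat.lt_succ_iff.1 i.2, he.symm⟩
  have hper (m) (hm : i ≤ m) : f^[m + (j - i)] x = f^[m] x := by
    obtain ⟨c, rfl⟩ := Nat.exists_eq_add_of_le hm
    rw [show i + c + (j - i) = c + j by omega, add_comm i c, Function.iterate_add_apply,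
      Function.iterate_add_apply, he]
  have hall (k) : f^[n + k] x ∈ lateOrbit f x n := by
    induction k using Nat.strong_induction_on with
    | _ k ih =>
      rcases lt_or_ge k n with hk | hk
      · exact Finset.mem_image.2 ⟨k, Finset.mem_range.2 hk, rfl⟩
      · have := ih (k - (j - i)) (by omega)
        rwa [← hper _ (by omega), show n + (k - (j - i)) + (j - i) = n + k by omega] at this
  have hmaps : Set.MapsTo f (lateOrbit f x n : Set α) (lateOrbit f x n) := by
    intro y hy
    obtain ⟨k, -, rfl⟩ := Finset.mem_image.1 (Finset.mem_coe.1 hy)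
    rw [← Function.iterate_succ_apply' f]
    exact hall (k + 1)
  refine ⟨?_, hmaps⟩
  have hsurj : Set.SurjOn f (lateOrbit f x n : Set α) (lateOrbit f x n) := by
    intro y hy
    obtain ⟨k, -, rfl⟩ := Finset.mem_image.1 (Finset.mem_coe.1 hy)
    -- The preimage is taken one period later, so that its time is at least `n` even for `k = 0`.
    refine ⟨f^[n + (k + (j - i) - 1)] x, hall _, ?_⟩
    rw [← Function.iterate_succ_apply' f, ← hper (n + k) (by omega)]
    congr 2
    omega
  exact Finset.injOn_of_surjOn_of_card_le f hmaps hsurj le_rfl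

/-! ### The second fully-labeled simplex -/

namespace AnotherSimplexInstance

variable (I : AnotherSimplexInstance)

/-- The sign with which the axis `i` occurs in the given simplex. -/
def sign : Fin (I.d + 1) → Bool := axisSign I.given

/-- The label of the vertex of the given simplex on the axis `i`. -/
def nearLabel (i : Fin (I.d + 1)) : Fin (I.d + 1) := I.label (i, I.sign i)

/-- The label of the antipode of the vertex of the given simplex on the axis `i`. -/
def farLabel (i : Fin (I.d + 1)) : Fin (I.d + 1) := I.label (i, !I.sign i)

theorem given_eq : I.given = orthantSimplex I.sign := I.fullyLabeled.eq_orthantSimplex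

theorem nearLabel_injective : Function.Injective I.nearLabel := I.fullyLabeled.injective_label

/-- The axis on which the given simplex has the label `c`. -/
noncomputable def axisOf : Fin (I.d + 1) → Fin (I.d + 1) :=
  (Equiv.ofBijective _ (Finite.injective_iff_bijective.1 I.nearLabel_injective)).symm

@[simp] theorem nearLabel_axisOf (c : Fin (I.d + 1)) : I.nearLabel (I.axisOf c) = c :=
  Equiv.ofBijective_apply_symm_apply _ _ _

@[simp] theorem axisOf_nearLabel (i : Fin (I.d + 1)) : I.axisOf (I.nearLabel i) = i :=
  I.nearLabel_injective (I.nearLabel_axisOf _)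

/-- The label that replaces `c` when the vertex labelled `c` is exchanged for its antipode. -/
noncomputable def succLabel (c : Fin (I.d + 1)) : Fin (I.d + 1) := I.farLabel (I.axisOf c)

/-- The labels on the cycle of `succLabel` reached from the first label. -/
noncomputable def cycleLabels : Finset (Fin (I.d + 1)) :=
  lateOrbit I.succLabel 0 (encodeInstance I).length

/-- The fully-labeled simplex obtained by exchanging all vertices with labels on the cycle for
their antipodes. -/
noncomputable def another : Finset (CPVertex I.d) :=
  orthantSimplex fun i => xor (I.sign i) (decide (I.nearLabel i ∈ I.cycleLabels))

/-- This lets the input length replace the number of labels as the waiting time before the cycle. -/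
theorem succ_d_le_length : I.d + 1 ≤ (encodeInstance I).length := by
  have : (cpVertexList I.d).length ≤ (encodeInstance I).length := by
    rw [encodeInstance, List.length_flatMap]
    refine List.length_le_sum_of_one_le _ ?_ |>.trans' (by simp)
    simp only [List.mem_map]
    rintro _ ⟨v, -, rfl⟩
    simp
  rw [length_cpVertexList] at this
  omega

theorem isFullyLabeled_another : IsFullyLabeled I.label I.another := by
  obtain ⟨hinj, hmaps⟩ := injOn_lateOrbit I.succLabel 0 (n := (encodeInstance I).length)
    (by simpa using I.succ_d_le_length)
  have hl (i) : I.label (i, xor (I.sign i) (decide (I.nearLabel i ∈ I.cycleLabels))) =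
      if I.nearLabel i ∈ I.cycleLabels then I.succLabel (I.nearLabel i) else I.nearLabel i := by
    split_ifs with h
    · simp only [h, decide_true, Bool.xor_true, succLabel, axisOf_nearLabel, farLabel]
    · rw [decide_eq_false h, Bool.xor_false, nearLabel]
  refine isFullyLabeled_orthantSimplex fun i j hij => ?_
  simp only [hl] at hij
  split_ifs at hij with hi hj hj
  -- Both axes are exchanged: `succLabel` is injective on the cycle. In the mixed cases the
  -- exchanged axis has a new label on the cycle and the other axis does not.
  · exact I.nearLabel_injective (hinj hi hj hij)
  · exact absurd (hij ▸ hmaps hi) hj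
  · exact absurd (hij ▸ hmaps hj) hi
  · exact I.nearLabel_injective hij

theorem another_ne_given : I.another ≠ I.given := by
  intro h
  let c := I.succLabel^[(encodeInstance I).length + 0] 0
  have hc : c ∈ I.cycleLabels := Finset.mem_image.2
    ⟨0, Finset.mem_range.2 (by have := I.succ_d_le_length; omega), rfl⟩
  have := Finset.ext_iff.1 h (I.axisOf c, I.sign (I.axisOf c))
  rw [I.given_eq] at this
  simp [another, hc] at this

end AnotherSimplexInstance

/-! ### The Turing machine -/

namespace AnotherSimplexMachine

open Turing StateTransition

/-- The stacks of the machine. Of each axis, `near` holds the reversed label of the vertex in the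
given simplex and a marker, and `far` holds the reversed label of its antipode; `near'` and `far'`
receive what has been scanned. `target` holds the label searched for, `target'` its part already
compared, `found` the label found, and the clocks are unary counters. -/
inductive Stack
  | inp | out | near | near' | far | far' | target | target' | found | clock₁ | clock₂
  deriving DecidableEq

instance : Fintype Stack where
  elems := {.inp, .out, .near, .near', .far, .far', .target, .target', .found, .clock₁, .clock₂}
  complete k := by cases k <;> simp

/-- A letter of the stack `near`: a bit of a label, or a marker ending a label, with the sign of
the axis and whether its vertices are to be exchanged. -/
abbrev NearLetter : Type := Bool ⊕ (Bool × Bool)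

/-- The alphabets of the stacks. -/
abbrev Alphabet : Stack → Type
  | .inp | .far | .far' => Option Bool
  | .near | .near' => NearLetter
  | .out | .target | .target' | .found => Bool
  | .clock₁ | .clock₂ => Unit

/-- The contents of all stacks. -/
structure Store where
  inp : List (Option Bool) := []
  out : List Bool := []
  near : List NearLetter := []
  near' : List NearLetter := []
  far : List (Option Bool) := []
  far' : List (Option Bool) := []
  target : List Bool := []
  target' : List Bool := []
  found : List Bool := []
  clock₁ : List Unit := []
  clock₂ : List Unit := []

/-- The contents of a stack. -/
@[simp] def Store.get (s : Store) : ∀ k, List (Alphabet k)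
  | .inp => s.inp
  | .out => s.out
  | .near => s.near
  | .near' => s.near'
  | .far => s.far
  | .far' => s.far'
  | .target => s.target
  | .target' => s.target'
  | .found => s.found
  | .clock₁ => s.clock₁
  | .clock₂ => s.clock₂

section Update

variable (s : Store)

-- These rules rewrite every stack operation as a record update, so that `simp` can execute single
-- steps of the program.
@[simp] theorem update_inp (x : List (Option Bool)) :
    Function.update s.get .inp x = { s with inp := x }.get := by
  funext k; cases k <;> rfl
@[simp] theorem update_out (x : List Bool) :
    Function.update s.get .out x = { s with out := x }.get := by
  funext k; cases k <;> rfl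
@[simp] theorem update_near (x : List NearLetter) :
    Function.update s.get .near x = { s with near := x }.get := by
  funext k; cases k <;> rfl
@[simp] theorem update_near' (x : List NearLetter) :
    Function.update s.get .near' x = { s with near' := x }.get := by
  funext k; cases k <;> rfl
@[simp] theorem update_far (x : List (Option Bool)) :
    Function.update s.get .far x = { s with far := x }.get := by
  funext k; cases k <;> rfl
@[simp] theorem update_far' (x : List (Option Bool)) :
    Function.update s.get .far' x = { s with far' := x }.get := by
  funext k; cases k <;> rfl
@[simp] theorem update_target (x : List Bool) :
    Function.update s.get .target x = { s with target := x }.get := by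
  funext k; cases k <;> rfl
@[simp] theorem update_target' (x : List Bool) :
    Function.update s.get .target' x = { s with target' := x }.get := by
  funext k; cases k <;> rfl
@[simp] theorem update_found (x : List Bool) :
    Function.update s.get .found x = { s with found := x }.get := by
  funext k; cases k <;> rfl
@[simp] theorem update_clock₁ (x : List Unit) :
    Function.update s.get .clock₁ x = { s with clock₁ := x }.get := by
  funext k; cases k <;> rfl
@[simp] theorem update_clock₂ (x : List Unit) :
    Function.update s.get .clock₂ x = { s with clock₂ := x }.get := by
  funext k; cases k <;> rfl

end Update

/-- The control states of the machine. -/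
inductive Label
  /-- Read the membership bit of a vertex; the argument tells whether it is some `e_i`. -/
  | loadVertex (positive : Bool)
  /-- Read the label of a vertex; the argument is its membership bit. -/
  | loadLabel (positive member : Bool)
  /-- Start the next round; go to `emit` after the last one. -/
  | next
  /-- Compare a label on `near` with the target. -/
  | compare (marking equal : Bool)
  /-- Restore the target. -/
  | restore (marking equal : Bool)
  /-- Skip a label on `far`, copying it to `found` if the comparison succeeded. -/
  | copy (marking equal : Bool)
  | clearTarget
  | rewindNear
  | rewindFar
  | setTarget
  | emit
  | clearFar
  | clearEnd
  deriving Fintype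

/-- The registers: a buffer for each kind of letter. -/
abbrev Registers : Type := Option (Option Bool) × Option NearLetter × Option Bool

/-- The registers when they are all empty. -/
abbrev idle : Registers := (none, none, none)

abbrev Statement : Type := TM2.Stmt Alphabet Label Registers

open TM2.Stmt

/-- Empty the registers, then continue with a control state computed from their contents. -/
abbrev jump (l : Label) : Statement := load (fun _ => idle) (goto fun _ => l)

/-- Pop a stack of bits; continue with one of two statements. -/
abbrev popBit (k : Stack) (f : Option (Alphabet k) → Option Bool) (q₁ q₂ : Statement) :
    Statement :=
  pop k (fun r x => (r.1, r.2.1, f x)) (branch (fun r => r.2.2.isSome) q₁ q₂)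

/-- The program of the machine. -/
def program : Label → Statement
  | .loadVertex positive =>
    pop .inp (fun _ x => (x, none, none)) <|
    branch (fun r => r.1.isSome)
      (push .clock₁ (fun _ => ()) <| push .clock₂ (fun _ => ()) <|
        branch (fun r => r.1 = some (some true))
          (push .near (fun _ => .inr (positive, false)) <| jump (.loadLabel positive true))
          (push .far (fun _ => none) <| jump (.loadLabel positive false)))
      -- The word `[true]` is the binary code of `1`, hence of the first label.
      (push .target (fun _ => true) <| jump .next)
  | .loadLabel positive member =>
    pop .inp (fun _ x => (x, none, none)) <|
    push .clock₁ (fun _ => ()) <| push .clock₂ (fun _ => ()) <|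
    branch (fun r => r.1 = some none)
      (jump (.loadVertex !positive))
      (branch (fun _ => member)
        (push .near (fun r => .inl (r.1 = some (some true))) <| jump (.loadLabel positive member))
        (push .far (fun r => r.1.join) <| jump (.loadLabel positive member)))
  | .next =>
    popBit .clock₁ (fun x => x.map fun _ => true) (jump (.compare false true)) <|
    popBit .clock₂ (fun x => x.map fun _ => true) (jump (.compare true true)) (jump .emit)
  | .compare marking equal =>
    pop .near (fun _ x => (none, x, none)) <|
    branch (fun r => r.2.1.isSome)
      (branch (fun r => (r.2.1.bind Sum.getLeft?).isSome)
        (push .near' (fun r => r.2.1.getD (.inl false)) <|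
          popBit .target id
            (push .target' (fun r => r.2.2.getD false) <|
              branch (fun r => r.2.1 = r.2.2.map Sum.inl)
                (jump (.compare marking equal)) (jump (.compare marking false)))
            (jump (.compare marking false)))
        (peek .target (fun r x => (r.1, r.2.1, x)) <|
          -- The target must be used up as well; otherwise the label is only a proper prefix of it.
          branch (fun r => equal && r.2.2.isNone)
            (push .near'
                (fun r => (r.2.1.getD (.inl false)).map id fun x => (x.1, x.2 || marking)) <|
              jump (.restore marking true))
            (push .near' (fun r => r.2.1.getD (.inl false)) <| jump (.restore marking false))))
      (jump .clearTarget)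
  | .restore marking equal =>
    popBit .target' id
      (push .target (fun r => r.2.2.getD false) <| jump (.restore marking equal))
      (jump (.copy marking equal))
  | .copy marking equal =>
    pop .far (fun _ x => (x, none, none)) <|
    push .far' (fun r => r.1.join) <|
    branch (fun r => r.1.join.isSome)
      (branch (fun _ => equal)
        (push .found (fun r => r.1.join.getD false) <| jump (.copy marking equal))
        (jump (.copy marking equal)))
      (jump (.compare marking true))
  | .clearTarget => popBit .target id (jump .clearTarget) (jump .rewindNear)
  | .rewindNear =>
    pop .near' (fun _ x => (none, x, none)) <|
    branch (fun r => r.2.1.isSome)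
      (push .near (fun r => r.2.1.getD (.inl false)) <| jump .rewindNear)
      (jump .rewindFar)
  | .rewindFar =>
    pop .far' (fun _ x => (x, none, none)) <|
    branch (fun r => r.1.isSome)
      (push .far (fun r => r.1.join) <| jump .rewindFar)
      (jump .setTarget)
  | .setTarget =>
    popBit .found id (push .target (fun r => r.2.2.getD false) <| jump .setTarget) (jump .next)
  | .emit =>
    pop .near (fun _ x => (none, x, none)) <|
    branch (fun r => r.2.1.isSome)
      (branch (fun r => (r.2.1.bind Sum.getLeft?).isSome)
        (jump .emit)
        -- The bit of `-e_i` is pushed first, so that it ends up below the bit of `e_i`.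
        (push .out (fun r => r.2.1.elim false (Sum.elim id fun x => !(xor x.1 x.2))) <|
          push .out (fun r => r.2.1.elim false (Sum.elim id fun x => xor x.1 x.2)) <|
          jump .emit))
      (jump .clearFar)
  | .clearFar =>
    pop .far (fun _ x => (x, none, none)) <|
    branch (fun r => r.1.isSome) (jump .clearFar) (jump .clearEnd)
  | .clearEnd => popBit .target id (jump .clearEnd) (load (fun _ => idle) halt)

/-- The machine. -/
def machine : FinTM2 where
  k₀ := .inp
  k₁ := .out
  Γ := Alphabet
  Λ := Label
  main := .loadVertex true
  σ := Registers
  initialState := idle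
  Γk₀Fin := inferInstanceAs (Fintype (Option Bool))
  m := program

/-! ### Runs of the machine and its elementary loops -/

/-- The configuration with given control state and stacks. -/
abbrev config (l : Option Label) (s : Store) : TM2.Cfg Alphabet Label Registers := ⟨l, idle, s.get⟩

/-- The machine gets from one configuration to another in at most `n` steps. -/
def Runs (n : ℕ) (l : Label) (s : Store) (l' : Option Label) (s' : Store) : Prop :=
  Nonempty (EvalsToInTime (TM2.step program) (config l s) (some (config l' s')) n)

theorem Runs.refl (l : Label) (s : Store) : Runs 0 l s l s := ⟨EvalsToInTime.refl _ _⟩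

theorem Runs.trans {m n : ℕ} {l l' : Label} {l'' : Option Label} {s s' s'' : Store}
    (h : Runs m l s l' s') (h' : Runs n l' s' l'' s'') : Runs (m + n) l s l'' s'' := by
  obtain ⟨h⟩ := h
  obtain ⟨h'⟩ := h'
  exact ⟨add_comm n m ▸ EvalsToInTime.trans _ _ _ _ _ _ h h'⟩

theorem Runs.mono {m n : ℕ} {l : Label} {l' : Option Label} {s s' : Store}
    (h : Runs m l s l' s') (hmn : m ≤ n) : Runs n l s l' s' := by
  obtain ⟨h⟩ := h
  exact ⟨⟨h.toEvalsTo, h.steps_le_m.trans hmn⟩⟩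

theorem Runs.single {l : Label} {l' : Option Label} {s s' : Store}
    (h : TM2.stepAux (program l) idle s.get = config l' s') : Runs 1 l s l' s' :=
  ⟨⟨⟨1, congrArg some h⟩, le_rfl⟩⟩

theorem Runs.head {n : ℕ} {l l' : Label} {l'' : Option Label} {s s' s'' : Store}
    (h : TM2.stepAux (program l) idle s.get = config l' s') (h' : Runs n l' s' l'' s'') :
    Runs (n + 1) l s l'' s'' :=
  add_comm n 1 ▸ (Runs.single h).trans h'

section Runs

variable (s : Store)

theorem runs_clearTarget (t : List Bool) :
    Runs (t.length + 1) .clearTarget { s with target := t } (some .rewindNear)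
      { s with target := [] } := by
  induction t with
  | nil => exact .single (by simp [program])
  | cons x t ih => exact .head (by simp [program]) ih

theorem runs_rewindNear (g : List NearLetter) :
    Runs (g.length + 1) .rewindNear { s with near' := g } (some .rewindFar)
      { s with near' := [], near := g.reverse ++ s.near } := by
  induction g generalizing s with
  | nil => exact .single (by simp [program])
  | cons x g ih =>
    simpa using Runs.head (by simp [program]) (ih { s with near := x :: s.near })

theorem runs_rewindFar (o : List (Option Bool)) :
    Runs (o.length + 1) .rewindFar { s with far' := o } (some .setTarget)
      { s with far' := [], far := o.reverse ++ s.far } := by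
  induction o generalizing s with
  | nil => exact .single (by simp [program])
  | cons x o ih =>
    simpa using Runs.head (by simp [program]) (ih { s with far := x :: s.far })

theorem runs_setTarget (w : List Bool) :
    Runs (w.length + 1) .setTarget { s with found := w } (some .next)
      { s with found := [], target := w.reverse ++ s.target } := by
  induction w generalizing s with
  | nil => exact .single (by simp [program])
  | cons x w ih =>
    simpa using Runs.head (by simp [program]) (ih { s with target := x :: s.target })

theorem runs_restore (p e : Bool) (w : List Bool) :
    Runs (w.length + 1) (.restore p e) { s with target' := w } (some (.copy p e))
      { s with target' := [], target := w.reverse ++ s.target } := by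
  induction w generalizing s with
  | nil => exact .single (by simp [program])
  | cons x w ih =>
    simpa using Runs.head (by simp [program]) (ih { s with target := x :: s.target })

theorem runs_copy (p e : Bool) (w : List Bool) (o : List (Option Bool)) :
    Runs (w.length + 1) (.copy p e) { s with far := w.map some ++ none :: o }
      (some (.compare p true))
      { s with far := o, far' := none :: (w.map some).reverse ++ s.far',
               found := (if e then w.reverse else []) ++ s.found } := by
  induction w generalizing s with
  | nil => exact .single (by cases e <;> simp [program])
  | cons x w ih =>
    cases e
    · simpa using Runs.head (by simp [program]) (ih { s with far' := some x :: s.far' })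
    · simpa using Runs.head (by simp [program])
        (ih { s with far' := some x :: s.far', found := x :: s.found })

/-- After a mismatch the scan still goes on to the marker, so that the whole label moves to `near'`;
the consumed part of the target is kept on `target'` for restoring. -/
theorem runs_compare (p e : Bool) (w t : List Bool) (b m : Bool) (g : List NearLetter) :
    Runs (w.length + 1) (.compare p e)
      { s with near := w.map .inl ++ .inr (b, m) :: g, target := t }
      (some (.restore p (e && decide (w = t))))
      { s with near := g
               near' := .inr (b, m || (p && (e && decide (w = t)))) ::
                 (w.map .inl).reverse ++ s.near'
               target := t.drop w.length
               target' := (t.take w.length).reverse ++ s.target' } := by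
  induction w generalizing s e t with
  | nil =>
    refine .single ?_
    cases e <;> cases t <;> simp [program]
  | cons x w ih =>
    cases t with
    | nil =>
      simpa using Runs.head (by simp [program])
        (ih { s with near' := .inl x :: s.near' } false [])
    | cons y t =>
      by_cases hxy : x = y
      · subst hxy
        simpa using Runs.head (by simp [program])
          (ih { s with near' := .inl x :: s.near', target' := x :: s.target' } e t)
      · simpa [hxy] using Runs.head (by simp [program, hxy])
          (ih { s with near' := .inl x :: s.near', target' := y :: s.target' } false t)

/-! ### One round: following a label -/

/-- What the machine stores about an axis: its sign, whether its vertices are to be exchanged, and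
the reversed labels of its vertices. -/
structure Axis where
  sign : Bool
  flip : Bool := false
  near : List Bool
  far : List Bool

/-- The contents of the stack `near`. -/
def nearWord (l : List Axis) : List NearLetter :=
  l.flatMap fun a => a.near.map .inl ++ [.inr (a.sign, a.flip)]

/-- The contents of the stack `far`. -/
def farWord (l : List Axis) : List (Option Bool) :=
  l.flatMap fun a => a.far.map some ++ [none]

/-- The label opposite to a near label. -/
def follow (l : List Axis) (t : List Bool) : List Bool :=
  (l.filter fun a => a.near = t).flatMap Axis.far

/-- Mark the axis with a given near label. -/
def Axis.mark (p : Bool) (t : List Bool) (a : Axis) : Axis :=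
  { a with flip := a.flip || (p && decide (a.near = t)) }

@[simp] theorem nearWord_nil : nearWord [] = [] := rfl

@[simp] theorem nearWord_cons (a : Axis) (l : List Axis) :
    nearWord (a :: l) = a.near.map .inl ++ .inr (a.sign, a.flip) :: nearWord l := by
  simp [nearWord]

@[simp] theorem farWord_nil : farWord [] = [] := rfl

@[simp] theorem farWord_cons (a : Axis) (l : List Axis) :
    farWord (a :: l) = a.far.map some ++ none :: farWord l := by
  simp [farWord]

@[simp] theorem follow_nil (t : List Bool) : follow [] t = [] := rfl

@[simp] theorem follow_cons (a : Axis) (l : List Axis) (t : List Bool) :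
    follow (a :: l) t = (if a.near = t then a.far else []) ++ follow l t := by
  by_cases h : a.near = t <;> simp [follow, h]

theorem nearWord_append (l l' : List Axis) : nearWord (l ++ l') = nearWord l ++ nearWord l' := by
  simp [nearWord]

theorem farWord_append (l l' : List Axis) : farWord (l ++ l') = farWord l ++ farWord l' := by
  simp [farWord]

/-- This keeps the target short in all rounds, whatever the number of matching axes. -/
theorem length_follow_le (l : List Axis) (t : List Bool) :
    (follow l t).length ≤ (farWord l).length := by
  induction l with
  | nil => simp
  | cons a l ih =>
    rw [follow_cons]
    split_ifs <;> simp <;> omega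

theorem length_le_length_farWord (l : List Axis) : l.length ≤ (farWord l).length := by
  induction l with
  | nil => simp
  | cons a l ih => simp; omega

theorem length_nearWord_mark (l : List Axis) (p : Bool) (t : List Bool) :
    (nearWord (l.map (Axis.mark p t))).length = (nearWord l).length := by
  induction l with
  | nil => rfl
  | cons a l ih => simp [Axis.mark, ← ih]

theorem farWord_mark (l : List Axis) (p : Bool) (t : List Bool) :
    farWord (l.map (Axis.mark p t)) = farWord l := by
  simp [farWord, List.flatMap_map, Axis.mark]

/-- Comparing and copying read each letter of `near` and `far` once; restoring the target costs at
most `t.length + 1` steps per axis. -/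
theorem runs_scan (p : Bool) (l : List Axis) (t : List Bool) :
    Runs ((nearWord l).length + (farWord l).length + (t.length + 1) * l.length + 1)
      (.compare p true) { s with near := nearWord l, far := farWord l, target := t, target' := [] }
      (some .clearTarget)
      { s with near := [], near' := (nearWord (l.map (Axis.mark p t))).reverse ++ s.near'
               far := [], far' := (farWord l).reverse ++ s.far', target := t, target' := []
               found := (follow l t).reverse ++ s.found } := by
  induction l generalizing s with
  | nil => exact .single (by simp [program])
  | cons a l ih =>
    let g : List NearLetter :=
      .inr (a.sign, a.flip || (p && decide (a.near = t))) :: (a.near.map .inl).reverse ++ s.near'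
    have h₁ := runs_compare { s with far := farWord (a :: l), target' := [] } p true a.near t
      a.sign a.flip (nearWord l)
    have h₂ := runs_restore { s with near := nearWord l, near' := g, far := farWord (a :: l)
                                     target := t.drop a.near.length }
      p (decide (a.near = t)) (t.take a.near.length).reverse
    have h₃ := runs_copy { s with near := nearWord l, near' := g, target' := [], target := t }
      p (decide (a.near = t)) a.far (farWord l)
    have h₄ := ih { s with
      near' := g
      far' := none :: (a.far.map some).reverse ++ s.far'
      found := (if a.near = t then a.far.reverse else []) ++ s.found }
    simp only [Bool.true_and, List.append_nil, List.reverse_reverse, List.take_append_drop,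
      decide_eq_true_eq] at h₁ h₂ h₃
    rw [farWord_cons] at h₁ h₂
    have hf : (follow (a :: l) t).reverse ++ s.found =
        (follow l t).reverse ++ ((if a.near = t then a.far.reverse else []) ++ s.found) := by
      rw [follow_cons]
      split_ifs <;> simp
    rw [hf, nearWord_cons, farWord_cons]
    have h := (h₁.trans h₂).trans (h₃.trans h₄)
    simp only [List.map_cons, nearWord_cons, List.reverse_append, List.reverse_cons,
      List.append_assoc, List.cons_append, g, Axis.mark] at h ⊢
    refine h.mono ?_
    have := min_le_right a.near.length t.length
    simp only [List.length_append, List.length_map, List.length_cons, List.length_reverse,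
      List.length_take]
    rw [Nat.mul_succ]
    omega

/-- The stacks between two rounds. -/
abbrev roundStore (l : List Axis) (t : List Bool) (m n : ℕ) : Store :=
  { near := nearWord l, far := farWord l, target := t
    clock₁ := .replicate m (), clock₂ := .replicate n () }

/-- The scan takes at most `L * L + 3 * L + 1` steps, and each of the four loops that clear or move
a stack at most `L + 1`. -/
theorem runs_round {L : ℕ} (p : Bool) (l : List Axis) (t : List Bool) (m n : ℕ)
    (hn : (nearWord l).length ≤ L) (hf : (farWord l).length ≤ L) (ht : t.length ≤ L) :
    Runs (L * L + 7 * L + 5) (.compare p true) (roundStore l t m n)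
      (some .next) (roundStore (l.map (Axis.mark p t)) (follow l t) m n) := by
  let c : Store := { clock₁ := .replicate m (), clock₂ := .replicate n () }
  have h₁ := runs_scan c p l t
  have h₂ := runs_clearTarget { c with
    near' := (nearWord (l.map (Axis.mark p t))).reverse
    far' := (farWord l).reverse, found := (follow l t).reverse } t
  have h₃ := runs_rewindNear { c with
    far' := (farWord l).reverse, found := (follow l t).reverse }
    (nearWord (l.map (Axis.mark p t))).reverse
  have h₄ := runs_rewindFar { c with
    near := nearWord (l.map (Axis.mark p t)), found := (follow l t).reverse }
    (farWord l).reverse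
  have h₅ := runs_setTarget { c with
    near := nearWord (l.map (Axis.mark p t)), far := farWord l } (follow l t).reverse
  simp only [List.append_nil, List.reverse_reverse, c] at h₁ h₂ h₃ h₄ h₅
  rw [roundStore, roundStore, farWord_mark]
  refine (h₁.trans (h₂.trans (h₃.trans (h₄.trans h₅)))).mono ?_
  have h₆ := length_follow_le l t
  have h₇ : (t.length + 1) * l.length ≤ L * L + L :=
    (Nat.mul_le_mul (Nat.succ_le_succ ht) ((length_le_length_farWord l).trans hf)).trans_eq
      (Nat.succ_mul L L)
  simp only [List.length_reverse, length_nearWord_mark]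
  omega

/-! ### Iterated rounds -/

/-- The data of the machine after some rounds. -/
def rounds (p : Bool) : ℕ → List Axis × List Bool → List Axis × List Bool
  | 0, x => x
  | n + 1, x => rounds p n (x.1.map (Axis.mark p x.2), follow x.1 x.2)

theorem length_rounds_le {L : ℕ} (p : Bool) (n : ℕ) (x : List Axis × List Bool)
    (hn : (nearWord x.1).length ≤ L) (hf : (farWord x.1).length ≤ L) (ht : x.2.length ≤ L) :
    (nearWord (rounds p n x).1).length ≤ L ∧ (farWord (rounds p n x).1).length ≤ L ∧
      (rounds p n x).2.length ≤ L := by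
  induction n generalizing x with
  | zero => exact ⟨hn, hf, ht⟩
  | succ n ih =>
    exact ih _ (by rwa [length_nearWord_mark]) (by rwa [farWord_mark])
      ((length_follow_le _ _).trans hf)

theorem runs_rounds_false {L : ℕ} (m n : ℕ) (x : List Axis × List Bool)
    (hn : (nearWord x.1).length ≤ L) (hf : (farWord x.1).length ≤ L) (ht : x.2.length ≤ L) :
    Runs (m * (L * L + 7 * L + 6)) .next (roundStore x.1 x.2 m n)
      (some .next) (roundStore (rounds false m x).1 (rounds false m x).2 0 n) := by
  induction m generalizing x with
  | zero => simpa [rounds] using Runs.refl _ _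
  | succ m ih =>
    have h₁ := runs_round false x.1 x.2 m n hn hf ht
    have h₂ := ih (x.1.map (Axis.mark false x.2), follow x.1 x.2)
      (by rwa [length_nearWord_mark]) (by rwa [farWord_mark]) ((length_follow_le _ _).trans hf)
    refine Runs.mono (.head (by simp [program, List.replicate_succ]) (h₁.trans h₂)) ?_
    rw [Nat.add_one_mul m]
    omega

theorem runs_rounds_true {L : ℕ} (n : ℕ) (x : List Axis × List Bool)
    (hn : (nearWord x.1).length ≤ L) (hf : (farWord x.1).length ≤ L) (ht : x.2.length ≤ L) :
    Runs (n * (L * L + 7 * L + 6)) .next (roundStore x.1 x.2 0 n)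
      (some .next) (roundStore (rounds true n x).1 (rounds true n x).2 0 0) := by
  induction n generalizing x with
  | zero => simpa [rounds] using Runs.refl _ _
  | succ n ih =>
    have h₁ := runs_round true x.1 x.2 0 n hn hf ht
    have h₂ := ih (x.1.map (Axis.mark true x.2), follow x.1 x.2)
      (by rwa [length_nearWord_mark]) (by rwa [farWord_mark]) ((length_follow_le _ _).trans hf)
    refine Runs.mono (.head (by simp [program, List.replicate_succ, roundStore]) (h₁.trans h₂)) ?_
    rw [Nat.add_one_mul n]
    omega

/-! ### Output and clean-up -/

/-- The membership bits of the two vertices of an axis after the exchange. -/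
def Axis.output (a : Axis) : List Bool := [xor a.sign a.flip, !(xor a.sign a.flip)]

theorem runs_emit_label (w : List Bool) (g : List NearLetter) :
    Runs w.length .emit { s with near := w.map .inl ++ g } (some .emit) { s with near := g } := by
  induction w with
  | nil => exact .refl _ _
  | cons x w ih => exact .head (by simp [program]) ih

theorem runs_emit (l : List Axis) :
    Runs ((nearWord l).length + 1) .emit { s with near := nearWord l } (some .clearFar)
      { s with near := [], out := l.reverse.flatMap Axis.output ++ s.out } := by
  induction l generalizing s with
  | nil => exact .single (by simp [program])
  | cons a l ih =>
    have h₁ := runs_emit_label s a.near (.inr (a.sign, a.flip) :: nearWord l)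
    have h₂ := ih { s with out := a.output ++ s.out }
    rw [nearWord_cons]
    have h := h₁.trans (.head (by simp [program, Axis.output]) h₂)
    simp only [List.length_append, List.length_map, List.length_cons, List.reverse_cons,
      List.flatMap_append, List.flatMap_singleton, List.append_assoc, add_assoc] at h ⊢
    exact h

/-- A halting configuration must have all stacks but the output empty. -/
theorem runs_clearFar (o : List (Option Bool)) :
    Runs (o.length + 1) .clearFar { s with far := o } (some .clearEnd) { s with far := [] } := by
  induction o with
  | nil => exact .single (by simp [program])
  | cons x o ih => exact .head (by simp [program]) ih

theorem runs_clearEnd (t : List Bool) :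
    Runs (t.length + 1) .clearEnd { s with target := t } none { s with target := [] } := by
  induction t with
  | nil => exact .single (by simp [program])
  | cons x t ih => exact .head (by simp [program]) ih

/-! ### Reading the input -/

/-- The part of the input that describes an axis. -/
def Axis.input (a : Axis) : List (Option Bool) :=
  (a.sign :: (if a.sign then a.near else a.far).reverse).map some ++ none ::
    (((!a.sign) :: (if a.sign then a.far else a.near).reverse).map some ++ [none])

/-- Both clocks gain one tick for each letter read, end markers included, so that they finally hold
the input length. -/
theorem runs_loadLabel_near (q : Bool) (w : List Bool) (u : List (Option Bool)) (c : ℕ) :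
    Runs (w.length + 1) (.loadLabel q true)
      { s with inp := w.map some ++ none :: u, clock₁ := .replicate c (), clock₂ := .replicate c () }
      (some (.loadVertex !q))
      { s with inp := u, near := (w.map .inl).reverse ++ s.near
               clock₁ := .replicate (c + w.length + 1) ()
               clock₂ := .replicate (c + w.length + 1) () } := by
  induction w generalizing s c with
  | nil => exact .single (by simp [program, List.replicate_succ])
  | cons x w ih =>
    have h := ih { s with near := .inl x :: s.near } (c + 1)
    rw [show c + 1 + w.length = c + (x :: w).length by simp; omega] at h
    simpa using Runs.head (by simp [program, List.replicate_succ]) h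

theorem runs_loadLabel_far (q : Bool) (w : List Bool) (u : List (Option Bool)) (c : ℕ) :
    Runs (w.length + 1) (.loadLabel q false)
      { s with inp := w.map some ++ none :: u, clock₁ := .replicate c (), clock₂ := .replicate c () }
      (some (.loadVertex !q))
      { s with inp := u, far := (w.map some).reverse ++ s.far
               clock₁ := .replicate (c + w.length + 1) ()
               clock₂ := .replicate (c + w.length + 1) () } := by
  induction w generalizing s c with
  | nil => exact .single (by simp [program, List.replicate_succ])
  | cons x w ih =>
    have h := ih { s with far := some x :: s.far } (c + 1)
    rw [show c + 1 + w.length = c + (x :: w).length by simp; omega] at h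
    simpa using Runs.head (by simp [program, List.replicate_succ]) h

theorem runs_loadVertex_near (q : Bool) (w : List Bool) (u : List (Option Bool)) (c : ℕ) :
    Runs (w.length + 2) (.loadVertex q)
      { s with inp := (true :: w.reverse).map some ++ none :: u
               clock₁ := .replicate c (), clock₂ := .replicate c () }
      (some (.loadVertex !q))
      { s with inp := u, near := w.map .inl ++ .inr (q, false) :: s.near
               clock₁ := .replicate (c + (w.length + 2)) ()
               clock₂ := .replicate (c + (w.length + 2)) () } := by
  have h := runs_loadLabel_near { s with near := .inr (q, false) :: s.near } q w.reverse u (c + 1)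
  rw [List.length_reverse, show c + 1 + w.length + 1 = c + (w.length + 2) by omega] at h
  simpa using Runs.head (by simp [program, List.replicate_succ]) h

theorem runs_loadVertex_far (q : Bool) (w : List Bool) (u : List (Option Bool)) (c : ℕ) :
    Runs (w.length + 2) (.loadVertex q)
      { s with inp := (false :: w.reverse).map some ++ none :: u
               clock₁ := .replicate c (), clock₂ := .replicate c () }
      (some (.loadVertex !q))
      { s with inp := u, far := w.map some ++ none :: s.far
               clock₁ := .replicate (c + (w.length + 2)) ()
               clock₂ := .replicate (c + (w.length + 2)) () } := by
  have h := runs_loadLabel_far { s with far := none :: s.far } q w.reverse u (c + 1)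
  rw [List.length_reverse, show c + 1 + w.length + 1 = c + (w.length + 2) by omega] at h
  simpa using Runs.head (by simp [program, List.replicate_succ]) h

theorem runs_loadAxis (a : Axis) (ha : a.flip = false) (u : List (Option Bool)) (c : ℕ) :
    Runs a.input.length (.loadVertex true)
      { s with inp := a.input ++ u, clock₁ := .replicate c (), clock₂ := .replicate c () }
      (some (.loadVertex true))
      { s with inp := u, near := nearWord [a] ++ s.near, far := farWord [a] ++ s.far
               clock₁ := .replicate (c + a.input.length) ()
               clock₂ := .replicate (c + a.input.length) () } := by
  obtain ⟨b, f, x, y⟩ := a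
  obtain rfl : f = false := ha
  cases b
  · have h₁ := runs_loadVertex_far s true y ((true :: x.reverse).map some ++ none :: u) c
    have h₂ := runs_loadVertex_near { s with far := y.map some ++ none :: s.far } false x u
      (c + (y.length + 2))
    have h := h₁.trans h₂
    have hl : (Axis.input ⟨false, false, x, y⟩).length = y.length + 2 + (x.length + 2) := by
      simp [Axis.input]; omega
    rw [hl, ← add_assoc c]
    simpa [Axis.input] using h
  · have h₁ := runs_loadVertex_near s true x ((false :: y.reverse).map some ++ none :: u) c
    have h₂ := runs_loadVertex_far { s with near := x.map .inl ++ .inr (true, false) :: s.near }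
      false y u (c + (x.length + 2))
    have h := h₁.trans h₂
    have hl : (Axis.input ⟨true, false, x, y⟩).length = x.length + 2 + (y.length + 2) := by
      simp [Axis.input]; omega
    rw [hl, ← add_assoc c]
    simpa [Axis.input] using h

/-- The axis read last lies on top, which reverses the list; `runs_emit` reverses it back. -/
theorem runs_load (l : List Axis) (hl : ∀ a ∈ l, a.flip = false) (c : ℕ) :
    Runs ((l.flatMap Axis.input).length + 1) (.loadVertex true)
      { s with inp := l.flatMap Axis.input
               clock₁ := .replicate c (), clock₂ := .replicate c () }
      (some .next)
      { s with inp := [], near := nearWord l.reverse ++ s.near, far := farWord l.reverse ++ s.far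
               target := true :: s.target
               clock₁ := .replicate (c + (l.flatMap Axis.input).length) ()
               clock₂ := .replicate (c + (l.flatMap Axis.input).length) () } := by
  induction l generalizing s c with
  | nil => exact .single (by simp [program])
  | cons a l ih =>
    have h₁ := runs_loadAxis s a (hl a (by simp)) (l.flatMap Axis.input) c
    have h₂ := ih { s with near := nearWord [a] ++ s.near, far := farWord [a] ++ s.far }
      (fun b hb => hl b (by simp [hb])) (c + a.input.length)
    have h := h₁.trans h₂
    simp only [List.flatMap_cons, List.length_append, List.reverse_cons, nearWord_append,
      farWord_append, List.append_assoc, add_assoc] at h ⊢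
    exact h

/-- The axes after the last round. -/
def finalAxes (l : List Axis) : List Axis :=
  let n := (l.flatMap Axis.input).length
  (rounds true n (rounds false n (l.reverse, [true]))).1

theorem length_nearWord_le (l : List Axis) :
    (nearWord l.reverse).length ≤ (l.flatMap Axis.input).length := by
  induction l with
  | nil => simp
  | cons a l ih =>
    simp only [List.reverse_cons, nearWord_append, List.flatMap_cons, List.length_append]
    have : (nearWord [a]).length ≤ a.input.length := by
      simp only [Axis.input]; split_ifs <;> simp <;> omega
    omega

theorem length_farWord_le (l : List Axis) :
    (farWord l.reverse).length ≤ (l.flatMap Axis.input).length := by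
  induction l with
  | nil => simp
  | cons a l ih =>
    simp only [List.reverse_cons, farWord_append, List.flatMap_cons, List.length_append]
    have : (farWord [a]).length ≤ a.input.length := by
      simp only [Axis.input]; split_ifs <;> simp <;> omega
    omega

end Runs

theorem runs_program (l : List Axis) (hl : ∀ a ∈ l, a.flip = false) (hne : l ≠ [])
    {L : ℕ} (hL : (l.flatMap Axis.input).length = L) :
    Runs (2 * L * (L * L + 7 * L + 6) + 4 * L + 5) (.loadVertex true)
      { inp := l.flatMap Axis.input } none
      { out := (finalAxes l).reverse.flatMap Axis.output } := by
  -- The initial target `[true]` has to respect the length bound `L`.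
  have hL1 : 1 ≤ L := by
    obtain ⟨a, l, rfl⟩ := List.exists_cons_of_ne_nil hne
    simp [← hL, Axis.input]
  let x := (l.reverse, [true])
  let y := rounds false L x
  let z := rounds true L y
  have h₁ := runs_load {} l hl 0
  rw [hL] at h₁
  obtain ⟨hy₁, hy₂, hy₃⟩ := length_rounds_le (L := L) false L x (hL ▸ length_nearWord_le l)
    (hL ▸ length_farWord_le l) hL1
  obtain ⟨hz₁, hz₂, hz₃⟩ := length_rounds_le (L := L) true L y hy₁ hy₂ hy₃
  have h₂ := runs_rounds_false (L := L) L L x (hL ▸ length_nearWord_le l)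
    (hL ▸ length_farWord_le l) hL1
  have h₃ := runs_rounds_true (L := L) L y hy₁ hy₂ hy₃
  have h₄ : Runs 1 .next (roundStore z.1 z.2 0 0) (some .emit) (roundStore z.1 z.2 0 0) :=
    .single (by simp [program, roundStore])
  have h₅ := runs_emit (roundStore z.1 z.2 0 0) z.1
  have h₆ := runs_clearFar { target := z.2, out := z.1.reverse.flatMap Axis.output } (farWord z.1)
  have h₇ := runs_clearEnd { out := z.1.reverse.flatMap Axis.output } z.2
  simp only [List.append_nil, zero_add, finalAxes, hL] at h₁ h₂ h₃ h₄ h₅ h₆ h₇ ⊢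
  refine (h₁.trans (h₂.trans (h₃.trans (h₄.trans (h₅.trans (h₆.trans h₇)))))).mono ?_
  rw [mul_assoc, two_mul]
  simp only [z]
  omega

/-! ### Correctness on encoded instances -/

/-- The reversed code of a label. -/
def labelCode {d : ℕ} (c : Fin (d + 1)) : List Bool := (encodeNat ((c : ℕ) + 1)).reverse

theorem labelCode_injective {d : ℕ} : Function.Injective (labelCode (d := d)) := by
  intro c c' h
  have := congrArg decodeNat (List.reverse_injective h)
  simp only [decode_encodeNat] at this
  omega

variable (I : AnotherSimplexInstance)

/-- The axes of an instance, with given exchange marks. -/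
def instanceAxes (m : Fin (I.d + 1) → Bool) : List Axis :=
  (List.finRange (I.d + 1)).map fun i =>
    ⟨I.sign i, m i, labelCode (I.nearLabel i), labelCode (I.farLabel i)⟩

theorem mem_given_iff (i : Fin (I.d + 1)) (b : Bool) :
    decide ((i, b) ∈ I.given) = (b == I.sign i) := by
  rw [I.given_eq]
  simp [Bool.beq_eq_decide_eq]

theorem encodeInstance_eq :
    encodeInstance I = (instanceAxes I fun _ => false).flatMap Axis.input := by
  rw [encodeInstance, cpVertexList, List.flatMap_assoc, instanceAxes, List.flatMap_map]
  congr 1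
  funext i
  simp only [List.flatMap_cons, List.flatMap_nil, mem_given_iff, Axis.input, labelCode,
    AnotherSimplexInstance.nearLabel, AnotherSimplexInstance.farLabel]
  cases h : I.sign i <;> simp

/-- The near labels are a bijection, so exactly one axis passes the filter. -/
theorem follow_instanceAxes (m : Fin (I.d + 1) → Bool) (c : Fin (I.d + 1)) :
    follow (instanceAxes I m).reverse (labelCode c) = labelCode (I.succLabel c) := by
  have h (i : Fin (I.d + 1)) : labelCode (I.nearLabel i) = labelCode c ↔ i = I.axisOf c := by
    rw [labelCode_injective.eq_iff]
    constructor <;> rintro rfl <;> simp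
  rw [follow, instanceAxes, ← List.map_reverse, List.filter_map, List.flatMap_map]
  simp only [Function.comp_def, h]
  rw [List.filter_eq, List.count_eq_one_of_mem (by simpa using List.nodup_finRange _) (by simp)]
  simp [AnotherSimplexInstance.succLabel]

theorem rounds_instanceAxes (p : Bool) (n : ℕ) (m : Fin (I.d + 1) → Bool) (c : Fin (I.d + 1)) :
    rounds p n ((instanceAxes I m).reverse, labelCode c) =
      ((instanceAxes I fun i => m i ||
        (p && decide (∃ k < n, I.succLabel^[k] c = I.nearLabel i))).reverse,
        labelCode (I.succLabel^[n] c)) := by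
  induction n generalizing m c with
  | zero => simp [rounds]
  | succ n ih =>
    have h : (instanceAxes I m).reverse.map (Axis.mark p (labelCode c)) =
        (instanceAxes I fun i => m i || (p && decide (c = I.nearLabel i))).reverse := by
      simp [instanceAxes, Axis.mark, labelCode_injective.eq_iff, eq_comm]
    simp only [rounds]
    rw [h, follow_instanceAxes, ih]
    refine Prod.ext (congrArg (fun f => (instanceAxes I f).reverse) (funext fun i => ?_)) rfl
    rw [Bool.or_assoc, ← Bool.and_or_distrib_left, ← Bool.decide_or]
    congr 3
    -- The first round marks the axis of `c` itself (`k = 0`); the other rounds start from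
    -- `succLabel c`.
    rw [Nat.exists_lt_succ_left]
    simp

/-- The unmarked rounds advance the target to time `n`, and the marked ones cover the times `n, …,
2n - 1`, which is the late orbit defining `cycleLabels`. -/
theorem output_finalAxes :
    (finalAxes (instanceAxes I fun _ => false)).reverse.flatMap Axis.output =
      encodeVertexSet ⟨I.d, I.another⟩ := by
  have h₁ : [true] = labelCode (0 : Fin (I.d + 1)) := by simp [labelCode]; rfl
  simp only [finalAxes]
  rw [h₁, rounds_instanceAxes, rounds_instanceAxes, ← encodeInstance_eq, List.reverse_reverse,
    instanceAxes, encodeVertexSet, cpVertexList, List.flatMap_map, List.map_flatMap]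
  congr 1
  funext i
  have h₂ : (∃ k < (encodeInstance I).length,
      I.succLabel^[k] (I.succLabel^[(encodeInstance I).length] 0) = I.nearLabel i) ↔
      I.nearLabel i ∈ I.cycleLabels := by
    simp [AnotherSimplexInstance.cycleLabels, lateOrbit, ← Function.iterate_add_apply, add_comm]
  simp only [h₂, Axis.output, AnotherSimplexInstance.another, mem_orthantSimplex]
  cases hs : I.sign i <;> by_cases h : I.nearLabel i ∈ I.cycleLabels <;> simp [h, hs]

/-! ### The polynomial time bound -/

theorem initList_machine (w : List (Option Bool)) :
    initList machine w = config (some (.loadVertex true)) { inp := w } := by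
  unfold initList
  congr 1
  funext k
  cases k <;> rfl

theorem haltList_machine (w : List Bool) :
    haltList machine w = config none { out := w } := by
  unfold haltList
  congr 1
  funext k
  cases k <;> rfl

open Polynomial in
/-- The machine solves the problem in polynomial time. -/
noncomputable def computableInPolyTime :
    TM2ComputableInPolyTime encodeInstance encodeVertexSet
      (fun I => (⟨I.d, I.another⟩ : Σ d : ℕ, Finset (CPVertex d))) where
  tm := machine
  inputAlphabet := Equiv.refl (Option Bool)
  outputAlphabet := Equiv.refl Bool
  time := 2 * X * (X * X + 7 * X + 6) + 4 * X + 5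
  outputsFun I := by
    refine Classical.choice ?_
    have h := runs_program (instanceAxes I fun _ => false) (by simp [instanceAxes])
      (by simp [instanceAxes]) rfl
    rw [output_finalAxes, ← encodeInstance_eq] at h
    have hi : (encodeInstance I).map (Equiv.refl (Option Bool)).invFun = encodeInstance I :=
      List.map_id _
    have ho : (encodeVertexSet ⟨I.d, I.another⟩).map (Equiv.refl Bool).invFun =
        encodeVertexSet ⟨I.d, I.another⟩ := List.map_id _
    unfold TM2OutputsInTime
    erw [hi, ho, initList_machine, Option.map_some, haltList_machine]
    convert h
    simp
    rfl

end AnotherSimplexMachine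

theorem mainTheorem9 :
    ∃ another : (I : AnotherSimplexInstance) → Finset (CPVertex I.d),
      (∀ I : AnotherSimplexInstance,
        IsFullyLabeled I.label (another I) ∧ another I ≠ I.given) ∧
      Nonempty (Turing.TM2ComputableInPolyTime encodeInstance encodeVertexSet
        (fun I => (⟨I.d, another I⟩ : Σ d : ℕ, Finset (CPVertex d)))) :=
  ⟨fun I => I.another, fun I => ⟨I.isFullyLabeled_another, I.another_ne_given⟩,
    ⟨AnotherSimplexMachine.computableInPolyTime⟩⟩
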